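/- For a group $G$ and $A\subseteq G$ let $\mathrm{Cyc}(A)=\{x\in G:\langle x\rangle\subseteq A\}$. A topological group $G$ has the algebraic small subgroup generating property (ASSGP) if $\langle \mathrm{Cyc}(U)\rangle=G$ for every neighbourhood $U$ of the identity, and the small subgroup generating property (SSGP) if $\langle \mathrm{Cyc}(U)\rangle$ is dense in $G$ for every neighbourhood $U$ of the identity. **Theorem.** Let $G$ be a free group with an infinite set $X$ of free generators. Then $G$ admits a Hausdorff group topology with the property ASSGP (and hence also with the property SSGP). -/

import Mathlib

open scoped Topology

/-- `Cyc A` is the set of all `x` whose cyclic subgroup `⟨x⟩` is contained in `A`. -/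
def Cyc {G : Type*} [Group G] (A : Set G) : Set G :=
  {x : G | (Subgroup.zpowers x : Set G) ⊆ A}

/-- The small subgroup generating property: `⟨Cyc U⟩` is dense in `G` for every
neighbourhood `U` of the identity. -/
def IsSSGP (G : Type*) [Group G] [TopologicalSpace G] : Prop :=
  ∀ U ∈ 𝓝 (1 : G), Dense (Subgroup.closure (Cyc U) : Set G)

/-- The algebraic small subgroup generating property: `⟨Cyc U⟩ = G` for every
neighbourhood `U` of the identity. -/
def IsASSGP (G : Type*) [Group G] [TopologicalSpace G] : Prop :=
  ∀ U ∈ 𝓝 (1 : G), Subgroup.closure (Cyc U) = ⊤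

open MeasureTheory
open scoped ENNReal Pointwise

/-! Since the generating set is infinite, index it by the nodes of a forest in which every node has
children `(n, i)` for all `n` and `i`. The first `n` children in block `n`, together with the
correction factor that turns their product into the parent, generate the group
(`closure_childFactors`). It suffices to find lengths that separate points and make the cyclic
groups of these factors uniformly short as `n` grows (`exists_t2_isASSGP`). Map the group to
functions on `[0, 1)` and measure supports, which do not grow under powers. For `n ≥ N` the children
are the parent's function cut into `n` pieces, so each has length at most `1 / n` and the correction
has length `0` (`supportLength_spread_le`). A fixed `g` involves finitely many generators, so for
large `N` it becomes a nontrivial constant, of length `1` (`eventually_spread_eq_const`). -/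

/-- A conjugation-invariant length function `ℓ` on `G` for which the cyclic subgroups generated by
the elements of `Z n` become uniformly short as `n` tends to infinity. -/
structure IsVanishingLength {G : Type*} [Group G] (Z : ℕ → Set G) (ℓ : G → ℝ≥0∞) : Prop where
  one : ℓ 1 = 0
  mul_le : ∀ a b, ℓ (a * b) ≤ ℓ a + ℓ b
  inv : ∀ a, ℓ a⁻¹ = ℓ a
  conj : ∀ a b, ℓ (a * b * a⁻¹) = ℓ b
  zpow_lt : ∀ ε : ℝ≥0∞, 0 < ε → ∃ n₀, ∀ n ≥ n₀, ∀ z ∈ Z n, ∀ k : ℤ, ℓ (z ^ k) < ε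

namespace IsVanishingLength

variable {G : Type*} [Group G] {Z : ℕ → Set G}

theorem zero : IsVanishingLength Z (fun _ => 0) where
  one := rfl
  mul_le _ _ := by simp
  inv _ := rfl
  conj _ _ := rfl
  zpow_lt _ hε := ⟨0, fun _ _ _ _ _ => hε⟩

theorem add {ℓ ℓ' : G → ℝ≥0∞} (h : IsVanishingLength Z ℓ) (h' : IsVanishingLength Z ℓ') :
    IsVanishingLength Z (fun a => ℓ a + ℓ' a) where
  one := by simp [h.one, h'.one]
  mul_le a b := (add_le_add (h.mul_le a b) (h'.mul_le a b)).trans_eq (add_add_add_comm _ _ _ _)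
  inv a := by rw [h.inv, h'.inv]
  conj a b := by rw [h.conj, h'.conj]
  zpow_lt ε hε := by
    have hε2 : 0 < ε / 2 := ENNReal.half_pos hε.ne'
    obtain ⟨n₁, h₁⟩ := h.zpow_lt _ hε2
    obtain ⟨n₂, h₂⟩ := h'.zpow_lt _ hε2
    refine ⟨max n₁ n₂, fun n hn z hz k => ?_⟩
    have := ENNReal.add_lt_add (h₁ n (le_of_max_le_left hn) z hz k)
      (h₂ n (le_of_max_le_right hn) z hz k)
    rwa [ENNReal.add_halves] at this

end IsVanishingLength

/-- The neighbourhoods of `1` in the finest topology defined by vanishing lengths. -/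
abbrev vanishingLengthBasis {G : Type*} [Group G] (Z : ℕ → Set G) : GroupFilterBasis G where
  sets := {U | ∃ ℓ, IsVanishingLength Z ℓ ∧ U = {a | ℓ a < 1}}
  nonempty := ⟨_, _, IsVanishingLength.zero, rfl⟩
  inter_sets := by
    rintro _ _ ⟨ℓ, h, rfl⟩ ⟨ℓ', h', rfl⟩
    exact ⟨_, ⟨_, h.add h', rfl⟩, fun a ha =>
      ⟨(le_self_add (a := ℓ a) (b := ℓ' a)).trans_lt ha,
        (le_add_self (a := ℓ' a) (b := ℓ a)).trans_lt ha⟩⟩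
  one' := by
    rintro _ ⟨ℓ, h, rfl⟩
    simp [h.one]
  mul' := by
    rintro _ ⟨ℓ, h, rfl⟩
    -- Doubling the length halves the radius of the unit ball.
    refine ⟨_, ⟨_, h.add h, rfl⟩, ?_⟩
    rintro _ ⟨a, ha, b, hb, rfl⟩
    simp only [Set.mem_ofPred_eq] at ha hb ⊢
    have half : ∀ c : ℝ≥0∞, c + c < 1 → c < 2⁻¹ := fun c hc => by
      by_contra! h2
      exact absurd hc (not_lt.2 ((ENNReal.inv_two_add_inv_two).symm.le.trans (add_le_add h2 h2)))
    calc ℓ (a * b) ≤ ℓ a + ℓ b := h.mul_le a b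
      _ < 2⁻¹ + 2⁻¹ := ENNReal.add_lt_add (half _ ha) (half _ hb)
      _ = 1 := ENNReal.inv_two_add_inv_two
  inv' := by
    rintro _ ⟨ℓ, h, rfl⟩
    exact ⟨_, ⟨_, h, rfl⟩, fun a ha => by simpa [h.inv] using ha⟩
  conj' := by
    rintro x _ ⟨ℓ, h, rfl⟩
    exact ⟨_, ⟨_, h, rfl⟩, fun a ha => by simpa [h.conj] using ha⟩

/-- If vanishing lengths separate points and all but finitely many of the sets `Z n` generate `G`,
then `G` admits a Hausdorff ASSGP group topology. -/
theorem exists_t2_isASSGP {G : Type*} [Group G] (Z : ℕ → Set G)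
    (hgen : ∃ n₀, ∀ n ≥ n₀, Subgroup.closure (Z n) = ⊤)
    (hsep : ∀ g : G, g ≠ 1 → ∃ ℓ, IsVanishingLength Z ℓ ∧ 1 ≤ ℓ g) :
    ∃ t : TopologicalSpace G, @IsTopologicalGroup G t _ ∧ @T2Space G t ∧ @IsASSGP G _ t := by
  let B := vanishingLengthBasis Z
  let _ : TopologicalSpace G := B.topology
  have _ : IsTopologicalGroup G := B.isTopologicalGroup
  refine ⟨inferInstance, inferInstance, ?_, ?_⟩
  · refine IsTopologicalGroup.t2Space_of_one_sep fun g hg => ?_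
    obtain ⟨ℓ, h, hℓ⟩ := hsep g hg
    exact ⟨_, B.nhds_one_hasBasis.mem_of_mem (i := {a | ℓ a < 1}) ⟨ℓ, h, rfl⟩, not_lt.2 hℓ⟩
  · intro U hU
    obtain ⟨_, ⟨ℓ, h, rfl⟩, hVU⟩ := B.nhds_one_hasBasis.mem_iff.1 hU
    obtain ⟨n₀, hn₀⟩ := hgen
    obtain ⟨n₁, hn₁⟩ := h.zpow_lt 1 one_pos
    rw [eq_top_iff, ← hn₀ (max n₀ n₁) (le_max_left _ _)]
    refine Subgroup.closure_mono fun z hz => ?_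
    rintro _ ⟨k, rfl⟩
    exact hVU (hn₁ _ (le_max_right _ _) z hz k)

/-- The length of `a` is the measure of the set of points of `[0, 1)` where the function `φ a` is
nontrivial. -/
noncomputable def supportLength {G : Type*} [Group G] (φ : G →* ℝ → G) (a : G) : ℝ≥0∞ :=
  volume (Set.Ico (0 : ℝ) 1 ∩ {t | φ a t ≠ 1})

theorem isVanishingLength_supportLength {G : Type*} [Group G] {Z : ℕ → Set G} (φ : G →* ℝ → G)
    (hZ : ∀ ε : ℝ≥0∞, 0 < ε → ∃ n₀, ∀ n ≥ n₀, ∀ z ∈ Z n, supportLength φ z < ε) :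
    IsVanishingLength Z (supportLength φ) where
  one := by simp [supportLength]
  mul_le a b := by
    refine (measure_mono ?_).trans (measure_union_le _ _)
    rintro t ⟨ht, hab⟩
    by_cases ha : φ a t = 1
    · exact Or.inr ⟨ht, fun hb => hab (by simp [ha, hb])⟩
    · exact Or.inl ⟨ht, ha⟩
  inv a := by simp [supportLength]
  conj a b := by simp [supportLength]
  zpow_lt ε hε := by
    obtain ⟨n₀, h⟩ := hZ ε hε
    -- The support of `z ^ k` lies in that of `z`, so one bound serves all `k`.
    refine ⟨n₀, fun n hn z hz k => (measure_mono ?_).trans_lt (h n hn z hz)⟩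
    rintro t ⟨ht, hk⟩
    exact ⟨ht, fun h1 => hk (by simp [h1])⟩

section Tree

variable {X G : Type*} [Group G] (b : FreeGroupBasis (X × List (ℕ × ℕ)) G)

/-- The ordered product of the first `n` generators in the `n`-th block of children of the node
`x`. -/
def childProd (x : X × List (ℕ × ℕ)) (n : ℕ) : G :=
  ((List.range n).map fun i => b (x.1, (n, i) :: x.2)).prod

/-- The elements `y₀, …, yₙ₋₁, (y₀ ⋯ yₙ₋₁)⁻¹ x`, for every generator `x` with `n`-th block of
children `y₀, y₁, …`. -/
def childFactors (n : ℕ) : Set G :=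
  ⋃ x : X × List (ℕ × ℕ),
    insert ((childProd b x n)⁻¹ * b x) ((fun i => b (x.1, (n, i) :: x.2)) '' Set.Iio n)

theorem FreeGroupBasis.closure_range_coe {ι H : Type*} [Group H] (c : FreeGroupBasis ι H) :
    Subgroup.closure (Set.range c) = ⊤ := by
  have hr : Set.range c = c.repr.symm.toMonoidHom '' Set.range FreeGroup.of := by
    rw [← Set.range_comp]
    rfl
  rw [hr, ← MonoidHom.map_closure, FreeGroup.closure_range_of, ← MonoidHom.range_eq_map]
  exact MonoidHom.range_eq_top.2 c.repr.symm.surjective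

theorem closure_childFactors (n : ℕ) : Subgroup.closure (childFactors b n) = ⊤ := by
  rw [eq_top_iff, ← b.closure_range_coe, Subgroup.closure_le]
  rintro _ ⟨x, rfl⟩
  have hp : childProd b x n ∈ Subgroup.closure (childFactors b n) := by
    refine Subgroup.list_prod_mem _ fun y hy => ?_
    obtain ⟨i, hi, rfl⟩ := List.mem_map.1 hy
    exact Subgroup.subset_closure
      (Set.mem_iUnion.2 ⟨x, Or.inr ⟨i, List.mem_range.1 hi, rfl⟩⟩)
  have hl : (childProd b x n)⁻¹ * b x ∈ Subgroup.closure (childFactors b n) :=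
    Subgroup.subset_closure (Set.mem_iUnion.2 ⟨x, Or.inl rfl⟩)
  simpa using mul_mem hp hl

/-- The generators in blocks before the `N`-th are sent to constant functions, and the `i`-th child
of `x` in a later block `n` to the restriction of the image of `x` to `[i / n, (i + 1) / n)`. -/
noncomputable def spreadNode (N : ℕ) (r : X) : List (ℕ × ℕ) → ℝ → G
  | [] => fun _ => b (r, [])
  | (n, i) :: l => fun t =>
      if n < N then b (r, (n, i) :: l) else if ⌊n * t⌋₊ = i then spreadNode N r l t else 1

/-- The homomorphism extending `spreadNode`. -/
noncomputable def spread (N : ℕ) : G →* ℝ → G :=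
  b.lift fun x => spreadNode b N x.1 x.2

theorem spread_basis (N : ℕ) (x : X × List (ℕ × ℕ)) :
    spread b N (b x) = spreadNode b N x.1 x.2 := by
  simp [spread]

theorem spread_child {N n : ℕ} (hn : N ≤ n) (x : X × List (ℕ × ℕ)) (i : ℕ) (t : ℝ) :
    spread b N (b (x.1, (n, i) :: x.2)) t = if ⌊n * t⌋₊ = i then spread b N (b x) t else 1 := by
  simp [spread_basis, spreadNode, not_lt.2 hn]

theorem List.prod_map_range_ite_eq {M : Type*} [Monoid M] (m j : ℕ) (v : M) :
    ((List.range m).map fun i => if j = i then v else 1).prod = if j < m then v else 1 := by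
  induction m with
  | zero => simp
  | succ m ih =>
    rw [List.range_succ, List.map_append, List.prod_append, ih]
    rcases lt_trichotomy j m with h | h | h
    · simp [h, h.ne, h.trans (Nat.lt_succ_self m)]
    · simp [h]
    · simp [h.not_gt, h.ne', not_lt.2 (Nat.succ_le_of_lt h)]

/-- At each point of `[0, 1)` exactly one of the `n` factors survives: the one with index `⌊n *
t⌋₊`. -/
theorem spread_childProd {N n : ℕ} (hn : N ≤ n) (h0 : 0 < n) (x : X × List (ℕ × ℕ)) {t : ℝ}
    (ht : t ∈ Set.Ico (0 : ℝ) 1) :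
    spread b N (childProd b x n) t = spread b N (b x) t := by
  have hfl : ⌊n * t⌋₊ < n := by
    rw [Nat.floor_lt (mul_nonneg n.cast_nonneg ht.1)]
    exact mul_lt_of_lt_one_right (by exact_mod_cast h0) ht.2
  have hev : spread b N (childProd b x n) t =
      ((Pi.evalMonoidHom (fun _ : ℝ => G) t).comp (spread b N)) (childProd b x n) := rfl
  rw [hev, childProd, map_list_prod, List.map_map]
  have hf : (((Pi.evalMonoidHom (fun _ : ℝ => G) t).comp (spread b N)) ∘
      fun i => b (x.1, (n, i) :: x.2)) =
      fun i => if ⌊n * t⌋₊ = i then spread b N (b x) t else 1 :=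
    funext fun i => spread_child b hn x i t
  rw [hf, List.prod_map_range_ite_eq, if_pos hfl]

theorem supportLength_spread_le {N n : ℕ} (hn : N ≤ n) (h0 : 0 < n) {z : G}
    (hz : z ∈ childFactors b n) : supportLength (spread b N) z ≤ (n : ℝ≥0∞)⁻¹ := by
  obtain ⟨x, rfl | ⟨i, -, rfl⟩⟩ := Set.mem_iUnion.1 hz
  · refine (measure_mono_null (t := ∅) ?_ measure_empty).trans_le zero_le
    rintro t ⟨ht, h⟩
    exact h (by simp [spread_childProd b hn h0 x ht])
  · have hn0 : (0 : ℝ) < n := by exact_mod_cast h0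
    have hsub : Set.Ico (0 : ℝ) 1 ∩ {t | spread b N (b (x.1, (n, i) :: x.2)) t ≠ 1} ⊆
        Set.Ico ((i : ℝ) / n) ((i + 1) / n) := by
      rintro t ⟨ht, h⟩
      rw [Set.mem_ofPred_eq, spread_child b hn] at h
      have hfl : ⌊n * t⌋₊ = i := by
        by_contra h'
        exact h (if_neg h')
      rw [Nat.floor_eq_iff (mul_nonneg n.cast_nonneg ht.1)] at hfl
      exact ⟨by rw [div_le_iff₀ hn0, mul_comm]; exact hfl.1,
        by rw [lt_div_iff₀ hn0, mul_comm]; exact hfl.2⟩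
    refine (measure_mono hsub).trans_eq ?_
    rw [Real.volume_Ico, ← sub_div, add_sub_cancel_left, one_div, ENNReal.ofReal_inv_of_pos hn0,
      ENNReal.ofReal_natCast]

theorem isVanishingLength_spread (N : ℕ) :
    IsVanishingLength (childFactors b) (supportLength (spread b N)) := by
  refine isVanishingLength_supportLength _ fun ε hε => ?_
  obtain ⟨m, hm⟩ := ENNReal.exists_inv_nat_lt hε.ne'
  -- Block `0` is excluded: its product is empty and cannot reproduce the parent.
  refine ⟨max (max N m) 1, fun n hn z hz => ?_⟩
  have h1 : N ≤ n := (le_max_left N m).trans (le_of_max_le_left hn)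
  have h2 : m ≤ n := (le_max_right N m).trans (le_of_max_le_left hn)
  exact (supportLength_spread_le b h1 (le_of_max_le_right hn) hz).trans_lt
    ((ENNReal.inv_le_inv.2 (by exact_mod_cast h2)).trans_lt hm)

theorem eventually_spread_eq_const (g : G) : ∀ᶠ N in Filter.atTop, spread b N g = fun _ => g := by
  have hg : g ∈ Subgroup.closure (Set.range b) := b.closure_range_coe ▸ Subgroup.mem_top g
  induction hg using Subgroup.closure_induction with
  | mem _ hx =>
    obtain ⟨⟨r, l⟩, rfl⟩ := hx
    rcases l with _ | ⟨⟨n, i⟩, l⟩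
    · exact Filter.Eventually.of_forall fun N => spread_basis b N _
    · filter_upwards [Filter.eventually_gt_atTop n] with N hN
      rw [spread_basis]
      funext t
      simp [spreadNode, hN]
  | one => exact Filter.Eventually.of_forall fun N => map_one _
  | mul x y _ _ hx hy =>
    filter_upwards [hx, hy] with N h1 h2
    rw [map_mul, h1, h2]
    rfl
  | inv x _ hx =>
    filter_upwards [hx] with N h1
    rw [map_inv, h1]
    rfl

theorem exists_t2_isASSGP_of_basis (b : FreeGroupBasis (X × List (ℕ × ℕ)) G) :
    ∃ t : TopologicalSpace G, @IsTopologicalGroup G t _ ∧ @T2Space G t ∧ @IsASSGP G _ t := by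
  refine exists_t2_isASSGP (childFactors b) ⟨0, fun n _ => closure_childFactors b n⟩
    fun g hg => ?_
  obtain ⟨N, hN⟩ := (eventually_spread_eq_const b g).exists
  exact ⟨_, isVanishingLength_spread b N, by simp [supportLength, hN, hg]⟩

end Tree

/-- An infinite cardinal absorbs the countable factor; this is where infinitude of `X` enters. -/
theorem nonempty_equiv_prod_list (X : Type*) [Infinite X] :
    Nonempty (X ≃ X × List (ℕ × ℕ)) := by
  rw [← Cardinal.lift_mk_eq'.{_, _}]
  simp [Cardinal.mk_prod, Cardinal.aleph0_le_mk]

theorem theorem2p4 {X : Type*} {G : Type*} [Group G] (b : FreeGroupBasis X G) (hX : Infinite X) :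
    ∃ t : TopologicalSpace G,
      @IsTopologicalGroup G t _ ∧ @T2Space G t ∧ @IsASSGP G _ t ∧ @IsSSGP G _ t := by
  obtain ⟨e⟩ := nonempty_equiv_prod_list X
  obtain ⟨t, h1, h2, h3⟩ := exists_t2_isASSGP_of_basis (b.reindex e)
  refine ⟨t, h1, h2, h3, fun U hU => ?_⟩
  rw [h3 U hU]
  exact dense_univ
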